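/- All rings are associative with $1$; "noetherian" means left and right noetherian, and ideals are two-sided. Let $k$ be a field. A $k$-algebra $R$ is an FCR-algebra if every finite dimensional representation of $R$ is completely reducible and the intersection of the kernels of all finite dimensional representations of $R$ is zero. A ring is indecomposable if it is nonzero and $0$ and $1$ are its only central idempotents. A countably generated projective right $R$-module $P$ is fair sized if the set of two-sided ideals $I$ of $R$ such that $P/PI$ is finitely generated has a minimal element with respect to inclusion. The trace ideal of $P$ is $\operatorname{Tr}(P)=\sum_{f\in\operatorname{Hom}_R(P,R)} f(P)$. **Theorem.** Let $R$ be an indecomposable, noetherian FCR-algebra over a field $k$ that is not finite dimensional over $k$, and let $I_0\subseteq R$ be an ideal of finite codimension, that is, $\dim_k R/I_0<\infty$. Then there are uncountably many pairwise non-isomorphic countably generated projective right $R$-modules $P$ that are not fair sized and whose trace ideal satisfies $\operatorname{Tr}(P)\subseteq I_0$. -/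

import Mathlib

universe u v w

/-- A ring is indecomposable if it is nonzero and it is not a product of two nonzero rings, i.e.
its only central idempotents are `0` and `1`. -/
structure IsIndecomposableRing (R : Type u) [Ring R] : Prop where
  nontrivial : Nontrivial R
  eq_zero_or_one : ∀ e : R, IsIdempotentElem e → e ∈ Subring.center R → e = 0 ∨ e = 1

/-- FCR-algebras over a field `k`: every finite dimensional representation is completely reducible,
and the intersection of the kernels of all finite dimensional representations is zero.
A finite dimensional representation is a (left) `R`-module, with compatible `k`-structure, that is
finite dimensional over `k`. The universe `max u v` contains a copy of every finite dimensional
`k`-vector space, hence of every finite dimensional representation. -/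
structure IsFCRAlgebra (k : Type v) (R : Type u) [Field k] [Ring R] [Algebra k R] : Prop where
  completely_reducible : ∀ (V : Type (max u v)) [AddCommGroup V] [Module k V] [Module R V]
    [IsScalarTower k R V] [FiniteDimensional k V], IsSemisimpleModule R V
  eq_zero_of_acts_as_zero : ∀ r : R,
    (∀ (V : Type (max u v)) [AddCommGroup V] [Module k V] [Module R V]
      [IsScalarTower k R V] [FiniteDimensional k V], ∀ x : V, r • x = 0) → r = 0

/-! Right `R`-modules are modules over `Rᵐᵒᵖ`; the right action `x r` is `MulOpposite.op r • x`. -/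

section RightModules

variable (R : Type u) [Ring R] (M : Type w) [AddCommGroup M] [Module Rᵐᵒᵖ M]

/-- A right module is countably generated if some countable subset generates it. -/
def IsCountablyGeneratedRight : Prop :=
  ∃ s : Set M, s.Countable ∧ Submodule.span Rᵐᵒᵖ s = ⊤

variable {R} in
/-- The submodule `M I` of a right module `M`, generated by the products `x r` with `r ∈ I`. -/
def mulRightIdeal (I : Ideal R) : Submodule Rᵐᵒᵖ M :=
  Submodule.span Rᵐᵒᵖ {y | ∃ x : M, ∃ r ∈ I, y = MulOpposite.op r • x}

/-- The set of two-sided ideals `I` of `R` such that `M / M I` is a finitely generated module. -/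
def finiteQuotientIdeals : Set (Ideal R) :=
  {I | I.IsTwoSided ∧ Module.Finite Rᵐᵒᵖ (M ⧸ mulRightIdeal M I)}

/-- `M` is fair sized if the set of two-sided ideals `I` with `M / M I` finitely generated has a
minimal element (used for countably generated projective modules). -/
def IsFairSized : Prop :=
  ∃ I : Ideal R, Minimal (fun J => J ∈ finiteQuotientIdeals R M) I

/-- The trace of a right module: the sum of the images of all homomorphisms `M → R` of right
modules. It is a two-sided ideal. -/
def traceIdeal : Ideal R where
  carrier := ((⨆ f : M →ₗ[Rᵐᵒᵖ] R, LinearMap.range f : Submodule Rᵐᵒᵖ R) : Set R)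
  add_mem' := fun ha hb => Submodule.add_mem _ ha hb
  zero_mem' := Submodule.zero_mem _
  smul_mem' := by
    intro r x hx
    let L : R →ₗ[Rᵐᵒᵖ] R :=
      { toFun := fun y => r * y
        map_add' := mul_add r
        map_smul' := fun c y => by simp [MulOpposite.smul_eq_mul_unop, mul_assoc] }
    have h : (⨆ f : M →ₗ[Rᵐᵒᵖ] R, LinearMap.range f : Submodule Rᵐᵒᵖ R) ≤
        (⨆ f : M →ₗ[Rᵐᵒᵖ] R, LinearMap.range f : Submodule Rᵐᵒᵖ R).comap L := by
      refine iSup_le fun f => ?_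
      rintro _ ⟨m, rfl⟩
      exact le_iSup (fun g : M →ₗ[Rᵐᵒᵖ] R => LinearMap.range g) (L.comp f) ⟨m, rfl⟩
    exact h hx

instance : (traceIdeal R M).IsTwoSided where
  mul_mem_of_left b ha :=
    Submodule.smul_mem (⨆ f : M →ₗ[Rᵐᵒᵖ] R, LinearMap.range f : Submodule Rᵐᵒᵖ R)
      (MulOpposite.op b) ha

end RightModules

/-!
Ideals of finite codimension in a noetherian FCR-algebra are idempotent (`IsFCRAlgebra.le_mul_self`):
`R / I²` is finite dimensional, hence semisimple, so its nilpotent ideal `I / I²` vanishes. When `R`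
is infinite dimensional, every such ideal is comaximal with a further proper one
(`IsFCRAlgebra.exists_comaximal`), which yields a descending sequence `I (n + 1) = I n ⊓ M n` with
`I n + M n = R`, starting at `I₀`.

A projective module whose quotients modulo all these ideals are prescribed is the colimit of a
sequence of free modules of finite rank, in the spirit of Whitehead's construction of projective
modules with a given idempotent trace ideal. The transition matrix `A n` is a square matrix `D n` on
top of a block column formed by left generators of `I n`. Here `D 0 = 0`, and `D (n + 1)` is `D n`
modulo `I n` and the identity modulo `M n`. Idempotence of `I (n + 1)` gives matrices `C n` with
`C n * A (n + 1) * A n = A n` (`IdealTower.exists_retraction`), and a sequential colimit with this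
property is projective (`SequentialColimit.projective`).

Since `A j` agrees with `D n` modulo `I n` for all `j ≥ n`, the colimit `P` satisfies `P = P I₀`, so
that its trace lies in `I₀`; all `P / P (I n)` are finitely generated; and `P / P (M n)` is free over
`R / M n` of the rank of the `(n + 1)`-st free module (`IdealTower.nonempty_quotient_equiv`). The
ideals `K` with `P / P K` finitely generated are closed under intersection, because `R` is right
noetherian, so a minimal one would be contained in every `I n`, and the number of generators of
`P / P K` would bound all these ranks; but the ranks grow without bound
(`IdealTower.not_isFairSized_colimit`). Repeating generators of the `I n` changes the ranks, which are
isomorphism invariants, in uncountably many ways.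
-/

/-! ### Sequential colimits of a module along endomorphisms -/

section SequentialColimit

variable {S : Type u} [Ring S] {F : Type w} [AddCommGroup F] [Module S F]

/-- The endomorphism of `⨁ₙ F` that sends `x` in degree `n` to `a n x` in degree `n + 1`. -/
noncomputable def sequentialShift (a : ℕ → Module.End S F) : (ℕ →₀ F) →ₗ[S] (ℕ →₀ F) :=
  Finsupp.lsum ℕ fun n => (Finsupp.lsingle (n + 1)).comp (a n)

/-- The colimit of the sequence `F → F → F → ⋯` of modules with transition maps `a n`, encoded as
the cokernel of `1 - shift` on `⨁ₙ F`. Constant terms avoid a family of types indexed by `ℕ`. -/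
abbrev SequentialColimit (a : ℕ → Module.End S F) : Type w :=
  (ℕ →₀ F) ⧸ LinearMap.range (LinearMap.id - sequentialShift a)

namespace SequentialColimit

variable (a : ℕ → Module.End S F)

/-- The structure map from the `n`-th term to the colimit. -/
noncomputable def of (n : ℕ) : F →ₗ[S] SequentialColimit a :=
  (Submodule.mkQ _).comp (Finsupp.lsingle n)

lemma of_succ (n : ℕ) (x : F) : of a (n + 1) (a n x) = of a n x := by
  symm
  rw [of, of, LinearMap.comp_apply, LinearMap.comp_apply, ← sub_eq_zero, ← map_sub,
    Submodule.mkQ_apply, Submodule.Quotient.mk_eq_zero]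
  exact ⟨Finsupp.single n x, by simp [sequentialShift]⟩

lemma exists_of_le {n : ℕ} (x : F) {m : ℕ} (h : n ≤ m) : ∃ y, of a m y = of a n x := by
  induction m, h using Nat.le_induction with
  | base => exact ⟨x, rfl⟩
  | succ m _ ih =>
    obtain ⟨y, hy⟩ := ih
    exact ⟨a m y, by rw [of_succ, hy]⟩

lemma exists_of (x : SequentialColimit a) : ∃ N, ∀ n, N ≤ n → ∃ y, of a n y = x := by
  obtain ⟨z, rfl⟩ := Submodule.mkQ_surjective _ x
  induction z using Finsupp.induction_linear with
  | zero => exact ⟨0, fun n _ => ⟨0, by simp⟩⟩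
  | add f g hf hg =>
    obtain ⟨N, hN⟩ := hf
    obtain ⟨K, hK⟩ := hg
    refine ⟨max N K, fun n hn => ?_⟩
    obtain ⟨y, hy⟩ := hN n (le_of_max_le_left hn)
    obtain ⟨y', hy'⟩ := hK n (le_of_max_le_right hn)
    exact ⟨y + y', by rw [map_add, map_add, hy, hy']⟩
  | single i x => exact ⟨i, fun n hn => exists_of_le a x hn⟩

variable {a} in
lemma hom_ext {N : Type*} [AddCommGroup N] [Module S N] {f g : SequentialColimit a →ₗ[S] N}
    (h : ∀ n x, f (of a n x) = g (of a n x)) : f = g := by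
  refine LinearMap.ext fun x => ?_
  obtain ⟨n, hn⟩ := exists_of a x
  obtain ⟨y, rfl⟩ := hn n le_rfl
  exact h n y

variable {a} in
/-- The universal property of the colimit. -/
noncomputable def desc {N : Type*} [AddCommGroup N] [Module S N] (g : ℕ → F →ₗ[S] N)
    (h : ∀ n x, g (n + 1) (a n x) = g n x) : SequentialColimit a →ₗ[S] N :=
  Submodule.liftQ _ (Finsupp.lsum ℕ g) <| by
    rintro _ ⟨z, rfl⟩
    induction z using Finsupp.induction_linear with
    | zero => simp
    | add f g hf hg => rw [map_add]; exact Submodule.add_mem _ hf hg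
    | single i x =>
      rw [LinearMap.mem_ker, LinearMap.sub_apply, map_sub, LinearMap.id_apply]
      simp [sequentialShift, h]

variable {a} in
@[simp] lemma desc_of {N : Type*} [AddCommGroup N] [Module S N] (g : ℕ → F →ₗ[S] N)
    (h : ∀ n x, g (n + 1) (a n x) = g n x) (n : ℕ) (x : F) : desc g h (of a n x) = g n x := by
  simp [desc, of]

/-- The composite `a (j + d) ∘ ⋯ ∘ a j`. -/
def forward : ℕ → ℕ → Module.End S F
  | 0, j => a j
  | d + 1, j => forward d (j + 1) * a j

/-- The composite `c n ∘ ⋯ ∘ c (n + d - 1)`. -/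
def backward (c : ℕ → Module.End S F) (n : ℕ) : ℕ → Module.End S F
  | 0 => 1
  | d + 1 => backward c n d * c (n + d)

variable {a} {c : ℕ → Module.End S F} (hc : ∀ n x, c n (a (n + 1) (a n x)) = a n x)
include hc

lemma backward_forward_succ (n j : ℕ) (x : F) :
    backward c n (j + 1 - n) (forward a (n - (j + 1)) (j + 1) (a j x)) =
      backward c n (j - n) (forward a (n - j) j x) := by
  rcases le_or_gt n j with h | h
  · obtain ⟨d, rfl⟩ := Nat.exists_eq_add_of_le h
    have h1 : n + d + 1 - n = d + 1 := by omega
    have h2 : n - (n + d + 1) = 0 := by omega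
    have h3 : n + d - n = d := by omega
    have h4 : n - (n + d) = 0 := by omega
    rw [h1, h2, h3, h4]
    simp only [backward, forward, Module.End.mul_apply, hc]
  · obtain ⟨d, rfl⟩ := Nat.exists_eq_add_of_lt h
    have h1 : j + 1 - (j + d + 1) = 0 := by omega
    have h2 : j + d + 1 - (j + 1) = d := by omega
    have h3 : j - (j + d + 1) = 0 := by omega
    have h4 : j + d + 1 - j = d + 1 := by omega
    rw [h1, h2, h3, h4]
    simp only [backward, forward, Module.End.mul_apply]

/-- If `c n ∘ a (n + 1) ∘ a n = a n` for all `n`, the map from the `n`-th term to the `(n + 1)`-st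
one extends to the colimit: on the `j`-th term with `j ≥ n` it is `c n ∘ ⋯ ∘ c (j - 1) ∘ a j`. -/
noncomputable def extend (n : ℕ) : SequentialColimit a →ₗ[S] F :=
  desc (fun j => backward c n (j - n) * forward a (n - j) j)
    (fun j x => backward_forward_succ hc n j x)

lemma extend_of (n : ℕ) (x : F) : extend hc n (of a n x) = a n x := by
  simp [extend, backward, forward]

/-- The approximations of a section of `⨁ₙ F → SequentialColimit a`. Writing `u n` for the structure
maps and `q n` for the extensions, the endomorphisms `u (n + 1) ∘ q n` of the colimit are the
identity on the image of `u n`, so that `1 = u 1 ∘ q 0 + ∑ₙ u (n + 2) ∘ (q (n + 1) - a (n + 1) ∘ q n)`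
is a locally finite sum; this is the lift of its partial sum. -/
noncomputable def sectionApprox (n : ℕ) : SequentialColimit a →ₗ[S] (ℕ →₀ F) :=
  (Finsupp.lsingle 0).comp (extend hc 0) + ∑ i ∈ Finset.range n,
    (Finsupp.lsingle (i + 1)).comp (extend hc (i + 1) - (a (i + 1)).comp (extend hc i))

lemma sectionApprox_succ (n : ℕ) (x : F) :
    sectionApprox hc (n + 1) (of a (n + 1) (a n x)) = sectionApprox hc n (of a n x) := by
  have h : extend hc (n + 1) (of a n x) = a (n + 1) (extend hc n (of a n x)) := by
    rw [extend_of, ← of_succ, extend_of]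
  simp [sectionApprox, of_succ, Finset.sum_range_succ, h]

lemma lsum_sectionApprox (n : ℕ) (x : SequentialColimit a) :
    Finsupp.lsum ℕ (fun n => of a (n + 1)) (sectionApprox hc n x) =
      of a (n + 1) (extend hc n x) := by
  induction n with
  | zero => simp [sectionApprox]
  | succ n ih =>
    have h : sectionApprox hc (n + 1) x = sectionApprox hc n x +
        Finsupp.single (n + 1) (extend hc (n + 1) x - a (n + 1) (extend hc n x)) := by
      simp [sectionApprox, Finset.sum_range_succ, add_assoc]
    rw [h, map_add, ih, Finsupp.lsum_single, map_sub, of_succ, add_sub_cancel]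

/-- A sequential colimit of a projective module along maps `a n` that satisfy
`c n ∘ a (n + 1) ∘ a n = a n` is projective. -/
theorem projective [Module.Projective S F] : Module.Projective S (SequentialColimit a) := by
  classical
  have : Module.Projective S (ℕ →₀ F) := .of_equiv (finsuppLequivDFinsupp (M := F) S).symm
  refine Module.Projective.of_split (M := ℕ →₀ F)
    (desc (fun n => (sectionApprox hc n).comp (of a n)) (sectionApprox_succ hc))
    (Finsupp.lsum ℕ fun n => of a (n + 1)) (hom_ext fun n x => ?_)
  rw [LinearMap.comp_apply, desc_of, LinearMap.comp_apply, lsum_sectionApprox, extend_of, of_succ,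
    LinearMap.id_apply]

end SequentialColimit

end SequentialColimit

/-! ### The submodules `M I` of a right module -/

section MulRightIdeal

open MulOpposite

variable {R : Type u} [Ring R]

section Module

variable {M : Type w} [AddCommGroup M] [Module Rᵐᵒᵖ M]

lemma op_smul_mem_mulRightIdeal {I : Ideal R} {r : R} (hr : r ∈ I) (x : M) :
    op r • x ∈ mulRightIdeal M I :=
  Submodule.subset_span ⟨x, r, hr, rfl⟩

lemma mulRightIdeal_mono {I J : Ideal R} (h : I ≤ J) : mulRightIdeal M I ≤ mulRightIdeal M J :=
  Submodule.span_mono fun _ ⟨x, r, hr, hy⟩ => ⟨x, r, h hr, hy⟩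

lemma mulRightIdeal_le_iff {I : Ideal R} {N : Submodule Rᵐᵒᵖ M} :
    mulRightIdeal M I ≤ N ↔ ∀ x : M, ∀ r ∈ I, op r • x ∈ N :=
  ⟨fun h x _ hr => h (op_smul_mem_mulRightIdeal hr x), fun h =>
    Submodule.span_le.2 fun _ ⟨x, r, hr, hy⟩ => hy ▸ h x r hr⟩

lemma map_mem_mulRightIdeal {N : Type*} [AddCommGroup N] [Module Rᵐᵒᵖ N] {I : Ideal R}
    (f : M →ₗ[Rᵐᵒᵖ] N) {x : M} (hx : x ∈ mulRightIdeal M I) : f x ∈ mulRightIdeal N I := by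
  have h : mulRightIdeal M I ≤ (mulRightIdeal N I).comap f :=
    mulRightIdeal_le_iff.2 fun x r hr => by
      simpa using op_smul_mem_mulRightIdeal hr (f x)
  exact h hx

lemma map_mulRightIdeal_equiv {N : Type*} [AddCommGroup N] [Module Rᵐᵒᵖ N] (I : Ideal R)
    (e : M ≃ₗ[Rᵐᵒᵖ] N) :
    (mulRightIdeal M I).map (e : M →ₗ[Rᵐᵒᵖ] N) = mulRightIdeal N I := by
  refine le_antisymm ?_ fun x hx => ?_
  · rintro _ ⟨x, hx, rfl⟩
    exact map_mem_mulRightIdeal _ hx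
  · exact ⟨e.symm x, map_mem_mulRightIdeal (e.symm : N →ₗ[Rᵐᵒᵖ] M) hx, by simp⟩

/-- If `y 0, …, y (r - 1)` generate the left ideal `I` and `J = J I`, then `M J` consists of the
sums `∑ w t * y t` with `w t ∈ M J`. -/
lemma exists_sum_of_mem_mulRightIdeal {I J : Ideal R} [J.IsTwoSided] {r : ℕ} {y : ℕ → R}
    (hy : ∀ b ∈ I, ∃ s : ℕ → R, b = ∑ t ∈ Finset.range r, s t * y t) (hJ : J ≤ J * I) {z : M}
    (hz : z ∈ mulRightIdeal M J) :
    ∃ w : ℕ → M, (∀ t, w t ∈ mulRightIdeal M J) ∧ z = ∑ t ∈ Finset.range r, op (y t) • w t := by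
  have key : ∀ b ∈ J, ∃ s : ℕ → R, (∀ t, s t ∈ J) ∧ b = ∑ t ∈ Finset.range r, s t * y t := by
    intro b hb
    refine Submodule.smul_induction_on (hJ hb) (fun a ha b hb => ?_) ?_
    · obtain ⟨s, rfl⟩ := hy b hb
      exact ⟨fun t => a * s t, fun t => J.mul_mem_right _ ha, by
        simp [Finset.mul_sum, mul_assoc]⟩
    · rintro _ _ ⟨s, hs, rfl⟩ ⟨s', hs', rfl⟩
      exact ⟨fun t => s t + s' t, fun t => J.add_mem (hs t) (hs' t), by
        simp [add_mul, Finset.sum_add_distrib]⟩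
  refine Submodule.closure_induction (p := fun z _ => ∃ w : ℕ → M,
    (∀ t, w t ∈ mulRightIdeal M J) ∧ z = ∑ t ∈ Finset.range r, op (y t) • w t) ?_ ?_ ?_ hz
  · exact ⟨0, fun _ => Submodule.zero_mem _, by simp⟩
  · rintro _ _ _ _ ⟨w, hw, rfl⟩ ⟨w', hw', rfl⟩
    exact ⟨fun t => w t + w' t, fun t => Submodule.add_mem _ (hw t) (hw' t), by
      simp [Finset.sum_add_distrib]⟩
  · rintro c _ ⟨x, b, hb, rfl⟩
    obtain ⟨s, hs, h⟩ := key (b * c.unop) (J.mul_mem_right _ hb)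
    refine ⟨fun t => op (s t) • x, fun t => op_smul_mem_mulRightIdeal (hs t) x, ?_⟩
    calc c • op b • x = op (b * c.unop) • x := by simp [smul_smul]
      _ = _ := by rw [h, Finset.op_sum, Finset.sum_smul]; simp [smul_smul]

end Module

section Free

lemma mem_mulRightIdeal_op {I : Ideal R} [I.IsTwoSided] {x : Rᵐᵒᵖ} :
    x ∈ mulRightIdeal Rᵐᵒᵖ I ↔ x.unop ∈ I := by
  refine ⟨fun h => ?_, fun h => by simpa using op_smul_mem_mulRightIdeal h (1 : Rᵐᵒᵖ)⟩
  refine Submodule.closure_induction (p := fun z _ => z.unop ∈ I) (by simp) ?_ ?_ h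
  · intro x y _ _ hx hy
    exact I.add_mem hx hy
  · rintro c _ ⟨x, b, hb, rfl⟩
    simpa [mul_assoc] using I.mul_mem_left x.unop (I.mul_mem_right c.unop hb)

/-- Right multiples by `I` in a free right module are detected on coordinates. -/
lemma mem_mulRightIdeal_finsupp {I : Ideal R} [I.IsTwoSided] {x : ℕ →₀ Rᵐᵒᵖ} :
    x ∈ mulRightIdeal (ℕ →₀ Rᵐᵒᵖ) I ↔ ∀ i, (x i).unop ∈ I := by
  refine ⟨fun h i => mem_mulRightIdeal_op.1 (map_mem_mulRightIdeal (Finsupp.lapply i) h),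
    fun h => ?_⟩
  rw [← Finsupp.sum_single x]
  exact Submodule.sum_mem _ fun i _ =>
    map_mem_mulRightIdeal (Finsupp.lsingle i) (mem_mulRightIdeal_op.2 (h i))

lemma mem_mulRightIdeal_inf {I J : Ideal R} [I.IsTwoSided] [J.IsTwoSided] [(I ⊓ J).IsTwoSided]
    {x : ℕ →₀ Rᵐᵒᵖ} (hI : x ∈ mulRightIdeal _ I) (hJ : x ∈ mulRightIdeal _ J) :
    x ∈ mulRightIdeal _ (I ⊓ J) :=
  mem_mulRightIdeal_finsupp.2 fun i =>
    ⟨mem_mulRightIdeal_finsupp.1 hI i, mem_mulRightIdeal_finsupp.1 hJ i⟩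

/-- A linear map out of a free right module has image in `N I` if the images of the basis have. -/
lemma apply_mem_mulRightIdeal_of_basis {N : Type*} [AddCommGroup N] [Module Rᵐᵒᵖ N] {I : Ideal R}
    (f : (ℕ →₀ Rᵐᵒᵖ) →ₗ[Rᵐᵒᵖ] N) (h : ∀ j, f (Finsupp.single j 1) ∈ mulRightIdeal N I)
    (x : ℕ →₀ Rᵐᵒᵖ) : f x ∈ mulRightIdeal N I := by
  induction x using Finsupp.induction_linear with
  | zero => simp
  | add x y hx hy => rw [map_add]; exact Submodule.add_mem _ hx hy
  | single j s =>
    rw [← mul_one s, ← smul_eq_mul, ← Finsupp.smul_single, map_smul]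
    exact Submodule.smul_mem _ _ (h j)

end Free

section CongruenceOnColimit

variable {F : Type w} [AddCommGroup F] [Module Rᵐᵒᵖ F] {a : ℕ → Module.End Rᵐᵒᵖ F} {J : Ideal R}
  {E : Module.End Rᵐᵒᵖ F} {n : ℕ}

/-- If, modulo `J`, the transition maps from the `n`-th one on agree with an idempotent map `E`,
then modulo `J` the colimit is the image of `E` on the `n`-th term. -/
lemma SequentialColimit.of_sub_of_mem (hE : ∀ x, E (E x) - E x ∈ mulRightIdeal F J)
    (ha : ∀ j, n ≤ j → ∀ x, a j x - E x ∈ mulRightIdeal F J) {j : ℕ} (hj : n ≤ j) (x : F) :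
    of a j x - of a n (E x) ∈ mulRightIdeal (SequentialColimit a) J := by
  have haE : ∀ j, n ≤ j → ∀ x, a j (E x) - E x ∈ mulRightIdeal F J := fun j hj x => by
    simpa using Submodule.add_mem _ (ha j hj (E x)) (hE x)
  have h1 : of a j x - of a j (E x) ∈ mulRightIdeal (SequentialColimit a) J := by
    rw [← of_succ a j x, ← of_succ a j (E x), ← map_sub]
    refine map_mem_mulRightIdeal _ ?_
    simpa using Submodule.sub_mem _ (ha j hj x) (haE j hj x)
  have h2 : of a j (E x) - of a n (E x) ∈ mulRightIdeal (SequentialColimit a) J := by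
    clear h1
    induction j, hj using Nat.le_induction with
    | base => simp
    | succ j hj ih =>
      have h3 : of a j (E x) - of a (j + 1) (E x) ∈ mulRightIdeal (SequentialColimit a) J := by
        rw [← of_succ a j (E x), ← map_sub]
        exact map_mem_mulRightIdeal _ (haE j hj x)
      simpa using Submodule.sub_mem _ ih h3
  simpa using Submodule.add_mem _ h1 h2

end CongruenceOnColimit

end MulRightIdeal

/-! ### Ideals of finite codimension in FCR-algebras -/

section FiniteCodimension

variable {k : Type v} {R : Type u} [Field k] [Ring R] [Algebra k R]

lemma finiteDimensional_quotient_of_linearMap {W : Type*} [AddCommGroup W] [Module k W]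
    [FiniteDimensional k W] {K : Ideal R} (f : R →ₗ[k] W) (hf : ∀ r, f r = 0 → r ∈ K) :
    FiniteDimensional k (R ⧸ K) := by
  have : FiniteDimensional k (R ⧸ LinearMap.ker f) :=
    Module.Finite.equiv f.quotKerEquivRange.symm
  let g : (R ⧸ LinearMap.ker f) →ₗ[k] R ⧸ K :=
    Submodule.liftQ _ (K.mkQ.restrictScalars k) fun r hr => by
      simpa using hf r hr
  refine Module.Finite.of_surjective g fun x => ?_
  obtain ⟨r, rfl⟩ := Submodule.mkQ_surjective _ x
  exact ⟨Submodule.Quotient.mk r, rfl⟩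

lemma finiteDimensional_quotient_mono {J K : Ideal R} (h : J ≤ K)
    [FiniteDimensional k (R ⧸ J)] : FiniteDimensional k (R ⧸ K) :=
  finiteDimensional_quotient_of_linearMap (J.mkQ.restrictScalars k) fun r hr => h (by simpa using hr)

lemma finiteDimensional_quotient_inf {I J : Ideal R} [FiniteDimensional k (R ⧸ I)]
    [FiniteDimensional k (R ⧸ J)] : FiniteDimensional k (R ⧸ (I ⊓ J)) := by
  refine finiteDimensional_quotient_of_linearMap
    ((I.mkQ.restrictScalars k).prod (J.mkQ.restrictScalars k)) fun r hr => ?_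
  simpa [Prod.ext_iff] using hr

lemma finiteDimensional_quotient_iff {I : Ideal R} : FiniteDimensional k (R ⧸ I) ↔
    ∃ T : Submodule k R, T.FG ∧ T ⊔ I.restrictScalars k = ⊤ := by
  constructor
  · intro h
    obtain ⟨T, hT⟩ := Submodule.exists_isCompl (I.restrictScalars k)
    have : FiniteDimensional k (R ⧸ I.restrictScalars k) :=
      Module.Finite.equiv (Submodule.Quotient.restrictScalarsEquiv k I).symm
    have : Module.Finite k T := Module.Finite.equiv (Submodule.quotientEquivOfIsCompl _ T hT)
    exact ⟨T, Module.Finite.iff_fg.1 this, by rw [sup_comm]; exact hT.sup_eq_top⟩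
  · rintro ⟨T, hT, h⟩
    have : Module.Finite k T := Module.Finite.iff_fg.2 hT
    refine Module.Finite.of_surjective ((I.mkQ.restrictScalars k).comp T.subtype) fun x => ?_
    obtain ⟨r, rfl⟩ := Submodule.mkQ_surjective _ x
    obtain ⟨t, ht, i, hi, rfl⟩ := Submodule.mem_sup.1 (h ▸ Submodule.mem_top : r ∈ _)
    refine ⟨⟨t, ht⟩, ?_⟩
    simpa using hi

/-- If `R = T + I` with `T` finite dimensional and `I` is generated by a finite set `s` as a left
ideal, then `I = T s + I s` and hence `R = T + T s + I I`. -/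
lemma finiteDimensional_quotient_mul_self [IsNoetherianRing R] {I : Ideal R}
    (h : FiniteDimensional k (R ⧸ I)) : FiniteDimensional k (R ⧸ I * I) := by
  obtain ⟨T, hT, hTI⟩ := finiteDimensional_quotient_iff.1 h
  obtain ⟨s, hs⟩ := (isNoetherianRing_iff_ideal_fg R).1 inferInstance I
  have hsI : ∀ x ∈ s, x ∈ I := fun x hx => hs ▸ Submodule.subset_span hx
  have decomp : ∀ r : R, ∃ t ∈ T, ∃ i ∈ I, t + i = r := fun r =>
    Submodule.mem_sup.1 (hTI ▸ Submodule.mem_top : r ∈ T ⊔ I.restrictScalars k)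
  refine finiteDimensional_quotient_iff.2 ⟨T ⊔ T * Submodule.span k (s : Set R),
    hT.sup (hT.mul ⟨s, rfl⟩), eq_top_iff.2 fun r _ => ?_⟩
  have key : ∀ x ∈ I, x ∈ T * Submodule.span k (s : Set R) ⊔ (I * I).restrictScalars k := by
    intro x hx
    rw [← hs] at hx
    refine Submodule.closure_induction
      (p := fun x _ => x ∈ T * Submodule.span k (s : Set R) ⊔ (I * I).restrictScalars k)
      (Submodule.zero_mem _) (fun _ _ _ _ => Submodule.add_mem _) (fun r x hx => ?_) hx
    obtain ⟨t, ht, i, hi, rfl⟩ := decomp r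
    rw [add_smul]
    exact Submodule.add_mem_sup (Submodule.mul_mem_mul ht (Submodule.subset_span hx))
      (Ideal.mul_mem_mul hi (hsI x hx))
  obtain ⟨t, ht, i, hi, rfl⟩ := decomp r
  rw [sup_assoc]
  exact Submodule.add_mem_sup ht (key i hi)

namespace IsFCRAlgebra

variable (hFCR : IsFCRAlgebra k R)
include hFCR

/-- Semisimplicity of `R / K` provides a complement `C` of `I` over `K`; the component of `1` in `I`
is a right identity of `I` modulo `K`, because `I C ⊆ I ∩ C = K`. -/
lemma exists_right_identity {I K : Ideal R} [I.IsTwoSided]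
    [FiniteDimensional k (R ⧸ K)] : ∃ a ∈ I, ∀ x ∈ I, x * (1 - a) ∈ K := by
  have hss : IsSemisimpleModule R (ULift.{v} (R ⧸ K)) :=
    hFCR.completely_reducible (ULift.{v} (R ⧸ K))
  have : IsSemisimpleModule R (R ⧸ K) := .congr ULift.moduleEquiv.symm
  obtain ⟨C, hC⟩ := exists_isCompl (Submodule.map K.mkQ I)
  obtain ⟨_, ⟨a, ha, rfl⟩, c, hc, hac⟩ := Submodule.mem_sup.1
    (hC.sup_eq_top ▸ Submodule.mem_top : K.mkQ 1 ∈ Submodule.map K.mkQ I ⊔ C)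
  have hca : c = K.mkQ (1 - a) := by rw [map_sub, ← hac, add_sub_cancel_left]
  refine ⟨a, ha, fun x hx => ?_⟩
  have h1 : K.mkQ (x * (1 - a)) ∈ Submodule.map K.mkQ I := ⟨_, I.mul_mem_right _ hx, rfl⟩
  have h2 : K.mkQ (x * (1 - a)) ∈ C := by
    rw [← smul_eq_mul, map_smul, ← hca]
    exact C.smul_mem x hc
  have h3 : K.mkQ (x * (1 - a)) ∈ (⊥ : Submodule R (R ⧸ K)) := hC.inf_eq_bot ▸ ⟨h1, h2⟩
  simpa using h3

/-- Ideals of finite codimension are idempotent. -/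
lemma le_mul_self [IsNoetherianRing R] {I : Ideal R} [I.IsTwoSided]
    (h : FiniteDimensional k (R ⧸ I)) : I ≤ I * I := by
  have := finiteDimensional_quotient_mul_self h
  obtain ⟨a, ha, h⟩ := hFCR.exists_right_identity (I := I) (K := I * I)
  intro x hx
  -- `x = x (1 - a) + x a`, and both terms lie in `I * I`.
  simpa [mul_sub] using (I * I).add_mem (h x hx) (Ideal.mul_mem_mul hx ha)

/-- Every ideal of finite codimension in an infinite dimensional algebra is comaximal with another
proper ideal of finite codimension: if `J` is the annihilator of a finite dimensional
representation that is not killed by `I`, take `{r | I r ⊆ J}`. -/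
lemma exists_comaximal (hdim : ¬ FiniteDimensional k R) (I : Ideal R) [I.IsTwoSided]
    (hI : FiniteDimensional k (R ⧸ I)) :
    ∃ (M : Ideal R) (e : R), M.IsTwoSided ∧ FiniteDimensional k (R ⧸ M) ∧ M ≠ ⊤ ∧ e ∈ M ∧
      1 - e ∈ I := by
  obtain ⟨x, hxI, hx0⟩ : ∃ x ∈ I, x ≠ 0 := by
    by_contra! h
    have hbot : FiniteDimensional k (R ⧸ (⊥ : Ideal R)) :=
      finiteDimensional_quotient_mono (J := I) h
    exact hdim (Module.Finite.equiv ((Submodule.quotEquivOfEqBot (⊥ : Ideal R) rfl).restrictScalars k))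
  have hrep := mt (hFCR.eq_zero_of_acts_as_zero x) hx0
  push Not at hrep
  obtain ⟨V, _, _, _, _, _, y, hy⟩ := hrep
  have hJ : FiniteDimensional k (R ⧸ Module.annihilator R V) :=
    finiteDimensional_quotient_of_linearMap (Algebra.lsmul k k V).toLinearMap fun r hr =>
      Module.mem_annihilator.2 fun z => by simpa using LinearMap.congr_fun hr z
  have := finiteDimensional_quotient_inf (k := k) (I := I) (J := Module.annihilator R V)
  obtain ⟨a, ha, h⟩ := hFCR.exists_right_identity
    (I := I) (K := I ⊓ Module.annihilator R V)
  let M : Ideal R :=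
    { carrier := {r | ∀ z ∈ I, z * r ∈ Module.annihilator R V}
      add_mem' := fun {r s} hr hs z hz => by
        rw [mul_add]; exact Ideal.add_mem _ (hr z hz) (hs z hz)
      zero_mem' := fun z _ => by simp
      smul_mem' := fun c r hr z hz => by
        rw [smul_eq_mul, ← mul_assoc]; exact hr _ (I.mul_mem_right c hz) }
  refine ⟨M, 1 - a, ⟨fun b hr z hz => ?_⟩, ?_, fun hM => ?_, fun z hz => (h z hz).2, by simpa⟩
  · rw [← mul_assoc]
    exact Ideal.mul_mem_right _ _ (hr z hz)
  · exact finiteDimensional_quotient_mono (J := Module.annihilator R V)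
      fun r hr z _ => Ideal.mul_mem_left _ z hr
  · have h1 : (1 : R) ∈ M := hM ▸ Submodule.mem_top
    exact hy (Module.mem_annihilator.1 (by simpa using h1 x hxI) y)

/-- A descending sequence of ideals of finite codimension, each obtained from the previous one by
intersecting with a comaximal proper ideal. -/
lemma exists_ideal_sequence (hdim : ¬ FiniteDimensional k R) (I₀ : Ideal R) (h₀ : I₀.IsTwoSided)
    (hI₀ : FiniteDimensional k (R ⧸ I₀)) :
    ∃ (I M : ℕ → Ideal R) (e : ℕ → R), I 0 = I₀ ∧ ∀ n,
      (I n).IsTwoSided ∧ FiniteDimensional k (R ⧸ I n) ∧ (M n).IsTwoSided ∧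
      FiniteDimensional k (R ⧸ M n) ∧ M n ≠ ⊤ ∧ e n ∈ M n ∧ 1 - e n ∈ I n ∧
      I (n + 1) = I n ⊓ M n := by
  choose M e hM hMfin hMtop heM heI using
    fun I : {I : Ideal R // I.IsTwoSided ∧ FiniteDimensional k (R ⧸ I)} =>
      have := I.2.1
      hFCR.exists_comaximal hdim I.1 I.2.2
  have hinf : ∀ I : {I : Ideal R // I.IsTwoSided ∧ FiniteDimensional k (R ⧸ I)},
      (I.1 ⊓ M I).IsTwoSided ∧ FiniteDimensional k (R ⧸ I.1 ⊓ M I) := by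
    intro I
    have := I.2.1
    have := I.2.2
    have := hM I
    have := hMfin I
    exact ⟨⟨fun b ha => ⟨I.1.mul_mem_right b ha.1, (M I).mul_mem_right b ha.2⟩⟩,
      finiteDimensional_quotient_inf⟩
  let J : ℕ → {I : Ideal R // I.IsTwoSided ∧ FiniteDimensional k (R ⧸ I)} := fun n =>
    Nat.rec ⟨I₀, h₀, hI₀⟩ (fun _ I => ⟨I.1 ⊓ M I, hinf I⟩) n
  exact ⟨fun n => (J n).1, fun n => M (J n), fun n => e (J n), rfl, fun n =>
    ⟨(J n).2.1, (J n).2.2, hM _, hMfin _, hMtop _, heM _, heI _, rfl⟩⟩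

end IsFCRAlgebra

end FiniteCodimension

/-! ### Maps of finite rank on a free right module of countable rank -/

section FreeRightModule

open MulOpposite Finsupp

variable {R : Type u} [Ring R]

lemma finsupp_op_hom_ext {N : Type*} [AddCommGroup N] [Module Rᵐᵒᵖ N]
    {f g : (ℕ →₀ Rᵐᵒᵖ) →ₗ[Rᵐᵒᵖ] N} (h : ∀ j, f (single j 1) = g (single j 1)) : f = g :=
  Finsupp.lhom_ext' fun j => LinearMap.ext_ring (h j)

/-- The projection of the free right module onto its first `m` coordinates. -/
noncomputable def truncation (R : Type u) [Ring R] (m : ℕ) : Module.End Rᵐᵒᵖ (ℕ →₀ Rᵐᵒᵖ) :=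
  linearCombination Rᵐᵒᵖ fun j => if j < m then single j 1 else 0

lemma truncation_single_one (m j : ℕ) :
    truncation R m (single j 1) = if j < m then single j 1 else 0 := by
  simp [truncation]

lemma truncation_single_of_lt {m j : ℕ} (h : j < m) (s : Rᵐᵒᵖ) :
    truncation R m (single j s) = single j s := by
  simp [truncation, h]

lemma truncation_single_of_le {m j : ℕ} (h : m ≤ j) (s : Rᵐᵒᵖ) :
    truncation R m (single j s) = 0 := by
  simp [truncation, not_lt.2 h]

lemma truncation_apply (m : ℕ) (x : ℕ →₀ Rᵐᵒᵖ) (i : ℕ) :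
    truncation R m x i = if i < m then x i else 0 := by
  induction x using Finsupp.induction_linear with
  | zero => simp
  | add x y hx hy => rw [map_add, Finsupp.add_apply, hx, hy, Finsupp.add_apply]; split_ifs <;> simp
  | single j s =>
    by_cases h : j < m
    · rw [truncation_single_of_lt h]
      split_ifs with hi
      · rfl
      · exact single_eq_of_ne (by rintro rfl; exact hi h)
    · rw [truncation_single_of_le (not_lt.1 h)]
      split_ifs with hi
      · exact (single_eq_of_ne (by rintro rfl; exact h hi)).symm
      · rfl

lemma truncation_truncation_of_le {m m' : ℕ} (h : m ≤ m') (x : ℕ →₀ Rᵐᵒᵖ) :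
    truncation R m' (truncation R m x) = truncation R m x := by
  ext i
  simp only [truncation_apply]
  split_ifs <;> first | rfl | omega

lemma truncation_truncation_of_ge {m m' : ℕ} (h : m' ≤ m) (x : ℕ →₀ Rᵐᵒᵖ) :
    truncation R m' (truncation R m x) = truncation R m' x := by
  ext i
  simp only [truncation_apply]
  split_ifs <;> first | rfl | omega

/-- Left multiplication by `e`, an endomorphism of the free right module. -/
noncomputable def leftMul (e : R) : Module.End Rᵐᵒᵖ (ℕ →₀ Rᵐᵒᵖ) :=
  mapRange.linearMap (LinearMap.toSpanSingleton Rᵐᵒᵖ Rᵐᵒᵖ (op e))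

lemma leftMul_apply (e : R) (x : ℕ →₀ Rᵐᵒᵖ) (i : ℕ) : leftMul e x i = x i * op e := by
  simp [leftMul]

lemma leftMul_mem {J : Ideal R} [J.IsTwoSided] {e : R} (he : e ∈ J) (x : ℕ →₀ Rᵐᵒᵖ) :
    leftMul e x ∈ mulRightIdeal _ J :=
  mem_mulRightIdeal_finsupp.2 fun i => by
    rw [leftMul_apply]
    exact J.mul_mem_right _ he

lemma sub_leftMul_mem {J : Ideal R} [J.IsTwoSided] {e : R} (he : 1 - e ∈ J) (x : ℕ →₀ Rᵐᵒᵖ) :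
    x - leftMul e x ∈ mulRightIdeal _ J :=
  mem_mulRightIdeal_finsupp.2 fun i => by
    rw [Finsupp.sub_apply, leftMul_apply]
    simpa [sub_mul] using J.mul_mem_right (x i).unop he

lemma truncation_leftMul (m : ℕ) (e : R) (x : ℕ →₀ Rᵐᵒᵖ) :
    truncation R m (leftMul e x) = leftMul e (truncation R m x) := by
  ext i
  simp only [truncation_apply, leftMul_apply]
  split_ifs <;> simp

/-- The block matrix with `m` columns whose rows of index `m * (t + 1), …, m * (t + 1) + m - 1`, for
`t < r`, form `y t` times the identity matrix, and whose other rows are zero. -/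
noncomputable def blockColumn (m r : ℕ) (y : ℕ → R) : Module.End Rᵐᵒᵖ (ℕ →₀ Rᵐᵒᵖ) :=
  linearCombination Rᵐᵒᵖ fun j =>
    if j < m then ∑ t ∈ Finset.range r, single (m * (t + 1) + j) (op (y t)) else 0

variable {m r : ℕ} {y : ℕ → R}

lemma blockColumn_single_one (j : ℕ) : blockColumn m r y (single j 1) =
    if j < m then ∑ t ∈ Finset.range r, single (m * (t + 1) + j) (op (y t)) else 0 := by
  simp [blockColumn]

lemma blockColumn_mem {I : Ideal R} [I.IsTwoSided] (hy : ∀ t, y t ∈ I) (x : ℕ →₀ Rᵐᵒᵖ) :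
    blockColumn m r y x ∈ mulRightIdeal _ I := by
  refine apply_mem_mulRightIdeal_of_basis _ (fun j => ?_) x
  rw [blockColumn_single_one]
  split_ifs
  · exact Submodule.sum_mem _ fun t _ =>
      map_mem_mulRightIdeal (lsingle _) (mem_mulRightIdeal_op.2 (hy t))
  · exact Submodule.zero_mem _

lemma blockColumn_truncation (x : ℕ →₀ Rᵐᵒᵖ) :
    blockColumn m r y (truncation R m x) = blockColumn m r y x := by
  refine LinearMap.congr_fun (f := (blockColumn m r y).comp (truncation R m))
    (finsupp_op_hom_ext fun j => ?_) x
  rw [LinearMap.comp_apply, truncation_single_one]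
  split_ifs with h
  · rfl
  · simp [blockColumn_single_one, h]

lemma truncation_blockColumn_eq_zero (x : ℕ →₀ Rᵐᵒᵖ) :
    truncation R m (blockColumn m r y x) = 0 := by
  refine LinearMap.congr_fun (f := (truncation R m).comp (blockColumn m r y)) (g := 0)
    (finsupp_op_hom_ext fun j => ?_) x
  rw [LinearMap.comp_apply, blockColumn_single_one]
  split_ifs with h
  · rw [map_sum]
    refine Finset.sum_eq_zero fun t _ => truncation_single_of_le ?_ _
    nlinarith [Nat.zero_le (m * t)]
  · simp

lemma truncation_blockColumn (x : ℕ →₀ Rᵐᵒᵖ) :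
    truncation R (m * (1 + r)) (blockColumn m r y x) = blockColumn m r y x := by
  refine LinearMap.congr_fun (f := (truncation R (m * (1 + r))).comp (blockColumn m r y))
    (finsupp_op_hom_ext fun j => ?_) x
  rw [LinearMap.comp_apply, blockColumn_single_one]
  split_ifs with h
  · rw [map_sum]
    refine Finset.sum_congr rfl fun t ht => truncation_single_of_lt ?_ _
    have h1 : t + 1 ≤ r := Finset.mem_range.1 ht
    calc m * (t + 1) + j < m * (t + 1) + m := by omega
      _ = m * (1 + (t + 1)) := by ring
      _ ≤ m * (1 + r) := by gcongr
  · simp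

/-- If `y` generates the left ideal `I` and `J = J I`, every matrix with `m` columns and entries in
`J` is a left multiple of the block column of `y` by a matrix with entries in `J`. -/
lemma exists_comp_blockColumn {I J : Ideal R} [J.IsTwoSided] (hm : 0 < m)
    (hy : ∀ b ∈ I, ∃ s : ℕ → R, b = ∑ t ∈ Finset.range r, s t * y t) (hJ : J ≤ J * I)
    {Z : Module.End Rᵐᵒᵖ (ℕ →₀ Rᵐᵒᵖ)} (hZ : ∀ x, Z (truncation R m x) = Z x)
    (hZJ : ∀ x, Z x ∈ mulRightIdeal _ J) :
    ∃ W : Module.End Rᵐᵒᵖ (ℕ →₀ Rᵐᵒᵖ), (∀ x, W x ∈ mulRightIdeal _ J) ∧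
      (∀ x, W (truncation R m x) = 0) ∧ ∀ x, W (blockColumn m r y x) = Z x := by
  choose w hwJ hw using fun j : ℕ => exists_sum_of_mem_mulRightIdeal hy hJ (hZJ (single j 1))
  -- A row index `i = m * (t + 1) + j` of a nonzero row of the block column determines `j` and `t`.
  let W : Module.End Rᵐᵒᵖ (ℕ →₀ Rᵐᵒᵖ) :=
    linearCombination Rᵐᵒᵖ fun i => if i < m then 0 else w (i % m) (i / m - 1)
  have hW : ∀ i s, W (single i s) = s • if i < m then 0 else w (i % m) (i / m - 1) :=
    fun i s => by simp [W]
  refine ⟨W, apply_mem_mulRightIdeal_of_basis W fun j => ?_, fun x => ?_, fun x => ?_⟩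
  · rw [hW, one_smul]
    split_ifs
    · exact Submodule.zero_mem _
    · exact hwJ _ _
  · refine LinearMap.congr_fun (f := W.comp (truncation R m)) (g := 0)
      (finsupp_op_hom_ext fun j => ?_) x
    rw [LinearMap.comp_apply, truncation_single_one]
    split_ifs with h
    · simp [hW, h]
    · simp
  · refine LinearMap.congr_fun (f := W.comp (blockColumn m r y)) (finsupp_op_hom_ext fun j => ?_) x
    rw [LinearMap.comp_apply, blockColumn_single_one]
    split_ifs with h
    · rw [map_sum, hw j]
      refine Finset.sum_congr rfl fun t _ => ?_
      have h1 : ¬ m * (t + 1) + j < m := by nlinarith [Nat.zero_le (m * t)]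
      have h2 : (m * (t + 1) + j) % m = j := by
        rw [Nat.mul_add_mod, Nat.mod_eq_of_lt h]
      have h3 : (m * (t + 1) + j) / m - 1 = t := by
        rw [Nat.mul_add_div hm, Nat.div_eq_of_lt h]; omega
      rw [hW, if_neg h1, h2, h3]
    · rw [map_zero, ← hZ, truncation_single_of_le (not_lt.1 h), map_zero]

end FreeRightModule

/-! ### The projective module of a tower of idempotent ideals -/

/-- A descending sequence of idempotent two-sided ideals `I n` with `I (n + 1) = I n ⊓ M n`, where
`I n` and `M n` are comaximal, together with elements `e n ∈ M n` with `1 - e n ∈ I n` and finite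
families `y n 0, …, y n (r n - 1)` of generators of the left ideals `I n`. The families may
be redundant, which leaves the numbers `r n` free to be enlarged. -/
structure IdealTower (R : Type u) [Ring R] where
  I : ℕ → Ideal R
  M : ℕ → Ideal R
  e : ℕ → R
  r : ℕ → ℕ
  y : ℕ → ℕ → R
  isTwoSided_I : ∀ n, (I n).IsTwoSided
  isTwoSided_M : ∀ n, (M n).IsTwoSided
  e_mem : ∀ n, e n ∈ M n
  one_sub_e_mem : ∀ n, 1 - e n ∈ I n
  I_succ : ∀ n, I (n + 1) = I n ⊓ M n
  I_le_mul_self : ∀ n, I n ≤ I n * I n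
  y_mem : ∀ n t, y n t ∈ I n
  exists_sum : ∀ n, ∀ b ∈ I n, ∃ s : ℕ → R, b = ∑ t ∈ Finset.range (r n), s t * y n t

namespace IdealTower

open MulOpposite Finsupp

variable {R : Type u} [Ring R] (T : IdealTower R)

attribute [instance] isTwoSided_I isTwoSided_M

/-- The rank of the `n`-th free module of the sequence; it is also the rank of the colimit
modulo `M (n - 1)`. -/
def rank : ℕ → ℕ
  | 0 => 1
  | n + 1 => rank n * (1 + T.r n)

/-- Matrices of size `rank n` that are idempotent modulo `I n`: the matrix `diag 0` is zero and
`diag (n + 1)` is `diag n` modulo `I n` and the identity modulo `M n`. -/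
noncomputable def diag : ℕ → Module.End Rᵐᵒᵖ (ℕ →₀ Rᵐᵒᵖ)
  | 0 => 0
  | n + 1 => leftMul (T.e n) * diag n +
      (truncation R (T.rank (n + 1)) - leftMul (T.e n) * truncation R (T.rank (n + 1)))

/-- The transition maps: the matrix `diag n` on top of the block column of the generators
of `I n`. -/
noncomputable def transition (n : ℕ) : Module.End Rᵐᵒᵖ (ℕ →₀ Rᵐᵒᵖ) :=
  T.diag n + blockColumn (T.rank n) (T.r n) (T.y n)

lemma rank_pos (n : ℕ) : 0 < T.rank n := by
  induction n with
  | zero => exact Nat.one_pos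
  | succ n ih => exact Nat.mul_pos ih (by omega)

lemma rank_le_succ (n : ℕ) : T.rank n ≤ T.rank (n + 1) :=
  Nat.le_mul_of_pos_right _ (by omega)

lemma lt_rank (hr : ∀ n, 0 < T.r n) (n : ℕ) : n < T.rank n := by
  induction n with
  | zero => exact Nat.one_pos
  | succ n ih =>
    have h : T.rank n * 2 ≤ T.rank (n + 1) := Nat.mul_le_mul_left _ (by have := hr n; omega)
    omega

lemma I_antitone : Antitone T.I :=
  antitone_nat_of_succ_le fun n => T.I_succ n ▸ inf_le_left

lemma I_succ_le_M (n : ℕ) : T.I (n + 1) ≤ T.M n :=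
  T.I_succ n ▸ inf_le_right

lemma diag_succ_apply (n : ℕ) (x : ℕ →₀ Rᵐᵒᵖ) : T.diag (n + 1) x =
    leftMul (T.e n) (T.diag n x) + (truncation R (T.rank (n + 1)) x -
      leftMul (T.e n) (truncation R (T.rank (n + 1)) x)) := rfl

lemma transition_apply (n : ℕ) (x : ℕ →₀ Rᵐᵒᵖ) : T.transition n x =
    T.diag n x + blockColumn (T.rank n) (T.r n) (T.y n) x := rfl

lemma truncation_diag (n : ℕ) (x : ℕ →₀ Rᵐᵒᵖ) :
    truncation R (T.rank n) (T.diag n x) = T.diag n x := by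
  induction n with
  | zero => simp [diag]
  | succ n ih =>
    have h : truncation R (T.rank (n + 1)) (T.diag n x) = T.diag n x := by
      rw [← ih, truncation_truncation_of_le (T.rank_le_succ n)]
    rw [diag_succ_apply, map_add, map_sub, truncation_leftMul, truncation_leftMul, h,
      truncation_truncation_of_le le_rfl]

lemma diag_truncation (n : ℕ) (x : ℕ →₀ Rᵐᵒᵖ) :
    T.diag n (truncation R (T.rank n) x) = T.diag n x := by
  induction n generalizing x with
  | zero => simp [diag]
  | succ n ih =>
    have h : T.diag n (truncation R (T.rank (n + 1)) x) = T.diag n x := by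
      rw [← ih (truncation R (T.rank (n + 1)) x),
        truncation_truncation_of_ge (T.rank_le_succ n), ih]
    rw [diag_succ_apply, h, truncation_truncation_of_le le_rfl, diag_succ_apply]

lemma diag_succ_sub_diag_mem (n : ℕ) (x : ℕ →₀ Rᵐᵒᵖ) :
    T.diag (n + 1) x - T.diag n x ∈ mulRightIdeal _ (T.I n) := by
  have h := sub_leftMul_mem (T.one_sub_e_mem n) (truncation R (T.rank (n + 1)) x - T.diag n x)
  rw [map_sub] at h
  rw [diag_succ_apply]
  convert h using 1
  abel

lemma diag_sub_diag_mem {n j : ℕ} (h : n ≤ j) (x : ℕ →₀ Rᵐᵒᵖ) :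
    T.diag j x - T.diag n x ∈ mulRightIdeal _ (T.I n) := by
  induction j, h using Nat.le_induction with
  | base => simp
  | succ j hj ih =>
    simpa using Submodule.add_mem _
      (mulRightIdeal_mono (T.I_antitone hj) (T.diag_succ_sub_diag_mem j x)) ih

lemma diag_succ_sub_truncation_mem (n : ℕ) (x : ℕ →₀ Rᵐᵒᵖ) :
    T.diag (n + 1) x - truncation R (T.rank (n + 1)) x ∈ mulRightIdeal _ (T.M n) := by
  have h := leftMul_mem (T.e_mem n) (T.diag n x - truncation R (T.rank (n + 1)) x)
  rw [map_sub] at h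
  rw [diag_succ_apply]
  convert h using 1
  abel

lemma mem_I_succ {n : ℕ} {x : ℕ →₀ Rᵐᵒᵖ} (hI : x ∈ mulRightIdeal _ (T.I n))
    (hM : x ∈ mulRightIdeal _ (T.M n)) : x ∈ mulRightIdeal _ (T.I (n + 1)) := by
  have := T.isTwoSided_I (n + 1)
  rw [T.I_succ n] at this ⊢
  exact mem_mulRightIdeal_inf hI hM

lemma diag_diag_sub_mem (n : ℕ) (x : ℕ →₀ Rᵐᵒᵖ) :
    T.diag n (T.diag n x) - T.diag n x ∈ mulRightIdeal _ (T.I n) := by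
  induction n with
  | zero => simp [diag]
  | succ n ih =>
    refine T.mem_I_succ ?_ ?_
    · have h1 := T.diag_succ_sub_diag_mem n (T.diag (n + 1) x)
      have h2 := T.diag_succ_sub_diag_mem n x
      have h3 := map_mem_mulRightIdeal (T.diag n) h2
      rw [map_sub] at h3
      have h4 := Submodule.sub_mem _ (Submodule.add_mem _ (Submodule.add_mem _ h1 h3) ih) h2
      convert h4 using 1
      abel
    · have h := T.diag_succ_sub_truncation_mem n (T.diag (n + 1) x)
      rwa [truncation_diag] at h

lemma transition_sub_diag_mem (n : ℕ) (x : ℕ →₀ Rᵐᵒᵖ) :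
    T.transition n x - T.diag n x ∈ mulRightIdeal _ (T.I n) := by
  rw [transition_apply, add_sub_cancel_left]
  exact blockColumn_mem (T.y_mem n) x

lemma truncation_transition (n : ℕ) (x : ℕ →₀ Rᵐᵒᵖ) :
    truncation R (T.rank (n + 1)) (T.transition n x) = T.transition n x := by
  rw [transition_apply, map_add, rank, truncation_blockColumn, ← T.truncation_diag n x,
    truncation_truncation_of_le (Nat.le_mul_of_pos_right _ (by omega))]

lemma transition_truncation (n : ℕ) (x : ℕ →₀ Rᵐᵒᵖ) :
    T.transition n (truncation R (T.rank n) x) = T.transition n x := by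
  rw [transition_apply, diag_truncation, blockColumn_truncation, transition_apply]

lemma truncation_transition_eq_diag (n : ℕ) (x : ℕ →₀ Rᵐᵒᵖ) :
    truncation R (T.rank n) (T.transition n x) = T.diag n x := by
  rw [transition_apply, map_add, truncation_blockColumn_eq_zero, truncation_diag, add_zero]

/-- The transition maps agree with `diag (n + 1) ∘ transition n` modulo `I (n + 1)`: modulo `I n`
because `diag n` is idempotent, modulo `M n` because `diag (n + 1)` is the identity there. -/
lemma transition_sub_diag_transition_mem (n : ℕ) (x : ℕ →₀ Rᵐᵒᵖ) :
    T.transition n x - T.diag (n + 1) (T.transition n x) ∈ mulRightIdeal _ (T.I (n + 1)) := by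
  refine T.mem_I_succ ?_ ?_
  · have h1 := T.transition_sub_diag_mem n x
    have h2 := T.diag_succ_sub_diag_mem n (T.transition n x)
    have h3 := map_mem_mulRightIdeal (T.diag n) h1
    rw [map_sub] at h3
    have h4 := Submodule.sub_mem _ (Submodule.sub_mem _ (Submodule.sub_mem _ h1 h2) h3)
      (T.diag_diag_sub_mem n x)
    convert h4 using 1
    abel
  · have h := Submodule.neg_mem _ (T.diag_succ_sub_truncation_mem n (T.transition n x))
    rwa [truncation_transition, neg_sub] at h

/-- The rows of `transition n` span all rows with entries in `I n`, so the error term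
`transition n - diag (n + 1) * transition n`, whose entries lie in the idempotent ideal `I (n + 1)`,
is a left multiple of `transition (n + 1) * transition n`. -/
lemma exists_retraction (n : ℕ) : ∃ c : Module.End Rᵐᵒᵖ (ℕ →₀ Rᵐᵒᵖ),
    ∀ x, c (T.transition (n + 1) (T.transition n x)) = T.transition n x := by
  have hI : T.I (n + 1) ≤ T.I (n + 1) * T.I n :=
    (T.I_le_mul_self (n + 1)).trans (Ideal.mul_mono_right (T.I_antitone n.le_succ))
  obtain ⟨W, hWI, hW0, hW⟩ := exists_comp_blockColumn
    (Z := T.transition n - T.diag (n + 1) * T.transition n) (T.rank_pos n) (T.exists_sum n) hI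
    (fun x => by simp [transition_truncation]) (T.transition_sub_diag_transition_mem n)
  obtain ⟨V, -, hV0, hV⟩ := exists_comp_blockColumn
    (Z := W * truncation R (T.rank (n + 1))) (T.rank_pos (n + 1)) (T.exists_sum (n + 1))
    (T.I_le_mul_self (n + 1)) (fun x => by simp [truncation_truncation_of_le le_rfl])
    (fun x => hWI _)
  refine ⟨truncation R (T.rank (n + 1)) + V, fun x => ?_⟩
  have h1 : V (T.transition (n + 1) (T.transition n x)) = W (T.transition n x) := by
    rw [transition_apply, map_add, hV, ← truncation_diag, hV0, zero_add, Module.End.mul_apply,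
      truncation_transition]
  have h2 : W (T.transition n x) = T.transition n x - T.diag (n + 1) (T.transition n x) := by
    rw [T.transition_apply n x, map_add, hW, ← T.truncation_diag n x, hW0, zero_add,
      T.truncation_diag n x]
    rfl
  rw [LinearMap.add_apply, truncation_transition_eq_diag, h1, h2, add_sub_cancel]

/-- The right module attached to a tower of ideals. -/
abbrev colimit : Type u := SequentialColimit T.transition

instance projective_colimit : Module.Projective Rᵐᵒᵖ T.colimit := by
  choose c hc using T.exists_retraction
  exact SequentialColimit.projective hc

lemma isCountablyGeneratedRight_colimit : IsCountablyGeneratedRight R T.colimit := by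
  refine ⟨Set.range fun p : ℕ × ℕ => SequentialColimit.of T.transition p.1 (single p.2 1),
    Set.countable_range _, eq_top_iff.2 fun x hx => ?_⟩
  obtain ⟨n, hn⟩ := SequentialColimit.exists_of _ x
  obtain ⟨z, rfl⟩ := hn n le_rfl
  clear hn hx
  induction z using Finsupp.induction_linear with
  | zero => simp
  | add f g hf hg => rw [map_add]; exact Submodule.add_mem _ hf hg
  | single j s =>
    rw [← mul_one s, ← smul_eq_mul, ← smul_single, map_smul]
    exact Submodule.smul_mem _ _ (Submodule.subset_span ⟨(n, j), rfl⟩)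

end IdealTower

/-! ### Quotients of the colimit -/

section FiniteQuotients

open MulOpposite

variable {R : Type u} [Ring R] {M : Type w} [AddCommGroup M] [Module Rᵐᵒᵖ M]

lemma finite_quotient_of_span_sup_eq_top {N : Submodule Rᵐᵒᵖ M} {s : Set M} (hs : s.Finite)
    (h : Submodule.span Rᵐᵒᵖ s ⊔ N = ⊤) : Module.Finite Rᵐᵒᵖ (M ⧸ N) := by
  refine ⟨⟨(hs.image N.mkQ).toFinset, ?_⟩⟩
  rw [Set.Finite.coe_toFinset, ← Submodule.map_span, eq_top_iff]
  intro x _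
  obtain ⟨x, rfl⟩ := N.mkQ_surjective x
  obtain ⟨y, hy, z, hz, rfl⟩ := Submodule.mem_sup.1
    (h ▸ Submodule.mem_top : x ∈ Submodule.span Rᵐᵒᵖ s ⊔ N)
  exact ⟨y, hy, by simpa using hz⟩

lemma exists_span_sup_eq_top (N : Submodule Rᵐᵒᵖ M) [Module.Finite Rᵐᵒᵖ (M ⧸ N)] :
    ∃ (m : ℕ) (p : Fin m → M), Submodule.span Rᵐᵒᵖ (Set.range p) ⊔ N = ⊤ := by
  obtain ⟨m, q, hq⟩ := Module.Finite.exists_fin (R := Rᵐᵒᵖ) (M := M ⧸ N)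
  choose p hp using fun i => N.mkQ_surjective (q i)
  refine ⟨m, p, ?_⟩
  have h : Submodule.map N.mkQ (Submodule.span Rᵐᵒᵖ (Set.range p)) = ⊤ := by
    rw [Submodule.map_span, ← hq, ← Set.range_comp]
    congr 2
    exact funext hp
  rw [sup_comm, ← Submodule.comap_map_mkQ, h, Submodule.comap_top]

/-- The ideals `I` with `M / M I` finitely generated are closed under finite intersections: if
`M = A + M I = B + M J` then `M = A + B I + M J I`, and `B I` is finitely generated along with
`B`. -/
lemma inf_mem_finiteQuotientIdeals [IsNoetherianRing Rᵐᵒᵖ] {I J : Ideal R}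
    (hI : I ∈ finiteQuotientIdeals R M) (hJ : J ∈ finiteQuotientIdeals R M) :
    I ⊓ J ∈ finiteQuotientIdeals R M := by
  obtain ⟨hI2, hIfin⟩ := hI
  obtain ⟨hJ2, hJfin⟩ := hJ
  refine ⟨⟨fun b ha => ⟨I.mul_mem_right b ha.1, J.mul_mem_right b ha.2⟩⟩, ?_⟩
  obtain ⟨m, p, hp⟩ := exists_span_sup_eq_top (mulRightIdeal M I)
  obtain ⟨n, q, hq⟩ := exists_span_sup_eq_top (mulRightIdeal M J)
  have hB : (Submodule.span Rᵐᵒᵖ (Set.range q)).FG := ⟨(Set.finite_range q).toFinset, by simp⟩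
  have : IsNoetherian Rᵐᵒᵖ (Submodule.span Rᵐᵒᵖ (Set.range q)) :=
    isNoetherian_of_fg_of_noetherian _ hB
  obtain ⟨s, hs⟩ := isNoetherian_submodule.1 this
    (Submodule.span Rᵐᵒᵖ {y | ∃ x ∈ Submodule.span Rᵐᵒᵖ (Set.range q), ∃ r ∈ I, y = op r • x})
    (Submodule.span_le.2 fun _ ⟨x, hx, r, _, hy⟩ => hy ▸ Submodule.smul_mem _ _ hx)
  refine finite_quotient_of_span_sup_eq_top ((Set.finite_range p).union s.finite_toSet) ?_
  rw [Submodule.span_union, hs, eq_top_iff, ← hp, sup_assoc]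
  refine sup_le_sup_left (mulRightIdeal_le_iff.2 fun x r hr => ?_) _
  obtain ⟨b, hb, z, hz, rfl⟩ := Submodule.mem_sup.1
    (hq ▸ Submodule.mem_top : x ∈ Submodule.span Rᵐᵒᵖ (Set.range q) ⊔ mulRightIdeal M J)
  rw [smul_add]
  refine Submodule.add_mem_sup (Submodule.subset_span ⟨b, hb, r, hr, rfl⟩) ?_
  refine Submodule.closure_induction (p := fun z _ => op r • z ∈ mulRightIdeal M (I ⊓ J)) ?_ ?_ ?_ hz
  · simp
  · intro x y _ _ hx hy
    rw [smul_add]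
    exact Submodule.add_mem _ hx hy
  · rintro c _ ⟨x, t, ht, rfl⟩
    have h : op r • c • op t • x = op (t * (c.unop * r)) • x := by simp [smul_smul, mul_assoc]
    rw [h]
    exact op_smul_mem_mulRightIdeal (I := I ⊓ J)
      (Submodule.mem_inf.2 ⟨I.mul_mem_left _ (I.mul_mem_left _ hr), J.mul_mem_right _ ht⟩) x

/-- A module generated by `m` elements modulo `M J` is, modulo `J`, a quotient of
`(R / J) ^ m`. -/
lemma length_quotient_le {J : Ideal R} [J.IsTwoSided] {m : ℕ} {p : Fin m → M}
    (h : Submodule.span Rᵐᵒᵖ (Set.range p) ⊔ mulRightIdeal M J = ⊤) :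
    Module.length Rᵐᵒᵖ (M ⧸ mulRightIdeal M J) ≤
      m * Module.length Rᵐᵒᵖ (Rᵐᵒᵖ ⧸ mulRightIdeal Rᵐᵒᵖ J) := by
  let g (i : Fin m) : (Rᵐᵒᵖ ⧸ mulRightIdeal Rᵐᵒᵖ J) →ₗ[Rᵐᵒᵖ] M ⧸ mulRightIdeal M J :=
    Submodule.mapQ _ _ (LinearMap.toSpanSingleton Rᵐᵒᵖ M (p i)) fun _ hx =>
      map_mem_mulRightIdeal _ hx
  let f : (Fin m → Rᵐᵒᵖ ⧸ mulRightIdeal Rᵐᵒᵖ J) →ₗ[Rᵐᵒᵖ] M ⧸ mulRightIdeal M J :=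
    ∑ i, (g i).comp (LinearMap.proj i)
  have hf : Function.Surjective f := by
    intro x
    obtain ⟨x, rfl⟩ := Submodule.mkQ_surjective _ x
    obtain ⟨y, hy, z, hz, rfl⟩ := Submodule.mem_sup.1
      (h ▸ Submodule.mem_top : x ∈ Submodule.span Rᵐᵒᵖ (Set.range p) ⊔ mulRightIdeal M J)
    obtain ⟨c, rfl⟩ := (Submodule.mem_span_range_iff_exists_fun Rᵐᵒᵖ).1 hy
    refine ⟨fun i => Submodule.Quotient.mk (c i), ?_⟩
    have hz' : (mulRightIdeal M J).mkQ z = 0 := by simpa using hz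
    rw [map_add, hz', add_zero, map_sum, LinearMap.sum_apply]
    rfl
  calc _ ≤ Module.length Rᵐᵒᵖ (Fin m → Rᵐᵒᵖ ⧸ mulRightIdeal Rᵐᵒᵖ J) :=
        Module.length_le_of_surjective f hf
    _ = _ := by rw [Module.length_pi]; simp

/-- If `M = M I`, every map `f : M → R` has image `f(M) I ⊆ I`. -/
lemma traceIdeal_le {I : Ideal R} [I.IsTwoSided] (h : mulRightIdeal M I = ⊤) :
    traceIdeal R M ≤ I := by
  intro t ht
  have h1 : (⨆ f : M →ₗ[Rᵐᵒᵖ] R, LinearMap.range f : Submodule Rᵐᵒᵖ R) ≤ mulRightIdeal R I := by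
    refine iSup_le fun f => ?_
    rintro _ ⟨x, rfl⟩
    exact map_mem_mulRightIdeal f (h ▸ Submodule.mem_top)
  refine Submodule.closure_induction (p := fun z _ => z ∈ I) I.zero_mem
    (fun _ _ _ _ => I.add_mem) ?_ (h1 ht)
  rintro c _ ⟨x, r, hr, rfl⟩
  exact I.mul_mem_right _ (I.mul_mem_left _ hr)

lemma length_quotient_ne_top {k : Type v} [Field k] [Algebra k R] (J : Ideal R) [J.IsTwoSided]
    (hJ : FiniteDimensional k (R ⧸ J)) :
    Module.length Rᵐᵒᵖ (Rᵐᵒᵖ ⧸ mulRightIdeal Rᵐᵒᵖ J) ≠ ⊤ := by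
  have : FiniteDimensional k (R ⧸ J.restrictScalars k) :=
    Module.Finite.equiv (Submodule.Quotient.restrictScalarsEquiv k J).symm
  let f : (R ⧸ J.restrictScalars k) →ₗ[k] Rᵐᵒᵖ ⧸ mulRightIdeal Rᵐᵒᵖ J :=
    Submodule.liftQ _ (((mulRightIdeal Rᵐᵒᵖ J).mkQ.restrictScalars k).comp
      (opLinearEquiv k : R ≃ₗ[k] Rᵐᵒᵖ).toLinearMap) fun r hr => by
        simpa [mem_mulRightIdeal_op] using hr
  have : FiniteDimensional k (Rᵐᵒᵖ ⧸ mulRightIdeal Rᵐᵒᵖ J) := by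
    refine Module.Finite.of_surjective f fun x => ?_
    obtain ⟨r, rfl⟩ := Submodule.mkQ_surjective _ x
    exact ⟨Submodule.Quotient.mk r.unop, rfl⟩
  have : IsNoetherian Rᵐᵒᵖ (Rᵐᵒᵖ ⧸ mulRightIdeal Rᵐᵒᵖ J) := isNoetherian_of_tower k inferInstance
  have : IsArtinian Rᵐᵒᵖ (Rᵐᵒᵖ ⧸ mulRightIdeal Rᵐᵒᵖ J) := isArtinian_of_tower k inferInstance
  exact Module.length_ne_top

lemma length_quotient_pos {J : Ideal R} [J.IsTwoSided] (hJ : J ≠ ⊤) :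
    0 < Module.length Rᵐᵒᵖ (Rᵐᵒᵖ ⧸ mulRightIdeal Rᵐᵒᵖ J) := by
  rw [Module.length_pos_iff, Submodule.Quotient.nontrivial_iff]
  intro h
  refine hJ ((Ideal.eq_top_iff_one _).2 ?_)
  exact mem_mulRightIdeal_op.1 (h ▸ Submodule.mem_top : (1 : Rᵐᵒᵖ) ∈ mulRightIdeal Rᵐᵒᵖ J)

end FiniteQuotients

namespace IdealTower

open MulOpposite Finsupp

variable {R : Type u} [Ring R] (T : IdealTower R)

/-- Modulo `I n`, the colimit is the image of `diag n` on the `n`-th term. -/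
lemma of_sub_of_diag_mem {n j : ℕ} (h : n ≤ j) (x : ℕ →₀ Rᵐᵒᵖ) :
    SequentialColimit.of T.transition j x - SequentialColimit.of T.transition n (T.diag n x) ∈
      mulRightIdeal T.colimit (T.I n) :=
  SequentialColimit.of_sub_of_mem (T.diag_diag_sub_mem n) (fun j hj x => by
    simpa using Submodule.add_mem _
      (mulRightIdeal_mono (T.I_antitone hj) (T.transition_sub_diag_mem j x))
      (T.diag_sub_diag_mem hj x)) h x

/-- As `diag 0 = 0`, the colimit vanishes modulo `I 0`. -/
lemma mulRightIdeal_colimit_I_zero : mulRightIdeal T.colimit (T.I 0) = ⊤ := by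
  refine eq_top_iff.2 fun x _ => ?_
  obtain ⟨n, hn⟩ := SequentialColimit.exists_of _ x
  obtain ⟨z, rfl⟩ := hn n le_rfl
  simpa [diag] using T.of_sub_of_diag_mem n.zero_le z

lemma I_mem_finiteQuotientIdeals (n : ℕ) : T.I n ∈ finiteQuotientIdeals R T.colimit := by
  refine ⟨T.isTwoSided_I n, finite_quotient_of_span_sup_eq_top
    (s := (fun j => SequentialColimit.of T.transition n (single j 1)) '' Set.Iio (T.rank n))
    ((Set.finite_Iio _).image _) (eq_top_iff.2 fun x _ => ?_)⟩
  obtain ⟨N, hN⟩ := SequentialColimit.exists_of _ x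
  obtain ⟨z, rfl⟩ := hN (max n N) (le_max_right _ _)
  have hspan : ∀ z, SequentialColimit.of T.transition n (truncation R (T.rank n) z) ∈
      Submodule.span Rᵐᵒᵖ
        ((fun j => SequentialColimit.of T.transition n (single j 1)) '' Set.Iio (T.rank n)) := by
    intro z
    induction z using Finsupp.induction_linear with
    | zero => simp
    | add f g hf hg => rw [map_add, map_add]; exact Submodule.add_mem _ hf hg
    | single j s =>
      rw [← mul_one s, ← smul_eq_mul, ← smul_single, map_smul, map_smul, truncation_single_one]
      refine Submodule.smul_mem _ _ ?_
      split_ifs with h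
      · exact Submodule.subset_span ⟨j, h, rfl⟩
      · simp
  have h := T.of_sub_of_diag_mem (le_max_left n N) z
  rw [← truncation_diag] at h
  simpa using Submodule.add_mem_sup (hspan (T.diag n z)) h

/-- The colimit modulo `M n` is free of rank `rank (n + 1)`. -/
lemma nonempty_quotient_equiv (n : ℕ) :
    Nonempty ((T.colimit ⧸ mulRightIdeal T.colimit (T.M n)) ≃ₗ[Rᵐᵒᵖ]
      (Fin (T.rank (n + 1)) → Rᵐᵒᵖ ⧸ mulRightIdeal Rᵐᵒᵖ (T.M n))) := by
  choose c hc using T.exists_retraction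
  have hE : ∀ x, truncation R (T.rank (n + 1)) (truncation R (T.rank (n + 1)) x) -
      truncation R (T.rank (n + 1)) x ∈ mulRightIdeal _ (T.M n) := fun x => by
    simp [truncation_truncation_of_le le_rfl]
  have hA : ∀ j, n + 1 ≤ j → ∀ x, T.transition j x - truncation R (T.rank (n + 1)) x ∈
      mulRightIdeal _ (T.M n) := fun j hj x => by
    have h1 := mulRightIdeal_mono ((T.I_antitone hj).trans (T.I_succ_le_M n))
      (T.transition_sub_diag_mem j x)
    have h2 := mulRightIdeal_mono (T.I_succ_le_M n) (T.diag_sub_diag_mem hj x)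
    simpa using Submodule.add_mem _ (Submodule.add_mem _ h1 h2)
      (T.diag_succ_sub_truncation_mem n x)
  have hof : ∀ j, n + 1 ≤ j → ∀ x, SequentialColimit.of T.transition j x -
      SequentialColimit.of T.transition (n + 1) (truncation R (T.rank (n + 1)) x) ∈
        mulRightIdeal T.colimit (T.M n) :=
    fun j hj x => SequentialColimit.of_sub_of_mem hE hA hj x
  let φ : T.colimit →ₗ[Rᵐᵒᵖ] (Fin (T.rank (n + 1)) → Rᵐᵒᵖ ⧸ mulRightIdeal Rᵐᵒᵖ (T.M n)) :=
    LinearMap.pi fun i => (mulRightIdeal Rᵐᵒᵖ (T.M n)).mkQ.comp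
      ((lapply (i : ℕ)).comp (SequentialColimit.extend hc (n + 1)))
  have hφ_apply : ∀ j, n + 1 ≤ j → ∀ x i, φ (SequentialColimit.of T.transition j x) i =
      (mulRightIdeal Rᵐᵒᵖ (T.M n)).mkQ (x i) := by
    intro j hj x i
    have h1 := map_mem_mulRightIdeal (SequentialColimit.extend hc (n + 1)) (hof j hj x)
    rw [map_sub, SequentialColimit.extend_of] at h1
    have h2 := Submodule.add_mem _ (Submodule.add_mem _ h1
      (hA (n + 1) le_rfl (truncation R (T.rank (n + 1)) x))) (hE x)
    have h3 := map_mem_mulRightIdeal (lapply (i : ℕ)) h2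
    rw [sub_add_sub_cancel, sub_add_sub_cancel, map_sub, lapply_apply, lapply_apply,
      truncation_apply, if_pos i.2] at h3
    exact (Submodule.Quotient.eq _).2 h3
  have hsurj : Function.Surjective φ := by
    intro v
    choose s hs using fun i => Submodule.mkQ_surjective _ (v i)
    refine ⟨SequentialColimit.of T.transition (n + 1)
      (∑ i : Fin (T.rank (n + 1)), single (i : ℕ) (s i)), ?_⟩
    ext i
    rw [hφ_apply _ le_rfl, ← hs i, Finsupp.finsetSum_apply,
      Finset.sum_eq_single i (fun i' _ h => single_eq_of_ne (fun h' => h (Fin.ext h'.symm)))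
        (by simp), single_eq_same]
  have hker : LinearMap.ker φ = mulRightIdeal T.colimit (T.M n) := by
    refine le_antisymm (fun x hx => ?_) (mulRightIdeal_le_iff.2 fun x r hr => ?_)
    · obtain ⟨N, hN⟩ := SequentialColimit.exists_of _ x
      obtain ⟨z, rfl⟩ := hN (max (n + 1) N) (le_max_right _ _)
      have hz : truncation R (T.rank (n + 1)) z ∈ mulRightIdeal _ (T.M n) := by
        refine mem_mulRightIdeal_finsupp.2 fun i => ?_
        rw [truncation_apply]
        split_ifs with hi
        · have h := hφ_apply _ (le_max_left (n + 1) N) z ⟨i, hi⟩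
          rw [LinearMap.mem_ker.1 hx] at h
          exact mem_mulRightIdeal_op.1 ((Submodule.Quotient.mk_eq_zero _).1 h.symm)
        · simp
      simpa using Submodule.add_mem _ (hof _ (le_max_left (n + 1) N) z)
        (map_mem_mulRightIdeal (SequentialColimit.of T.transition (n + 1)) hz)
    · rw [LinearMap.mem_ker]
      ext i
      have h := map_mem_mulRightIdeal ((lapply (i : ℕ)).comp
        (SequentialColimit.extend hc (n + 1))) (op_smul_mem_mulRightIdeal hr x)
      exact (Submodule.Quotient.mk_eq_zero _).2 h
  exact ⟨(Submodule.quotEquivOfEq _ _ hker.symm).trans (φ.quotKerEquivOfSurjective hsurj)⟩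

lemma length_colimit_quotient (n : ℕ) :
    Module.length Rᵐᵒᵖ (T.colimit ⧸ mulRightIdeal T.colimit (T.M n)) =
      T.rank (n + 1) * Module.length Rᵐᵒᵖ (Rᵐᵒᵖ ⧸ mulRightIdeal Rᵐᵒᵖ (T.M n)) := by
  rw [(T.nonempty_quotient_equiv n).some.length_eq, Module.length_pi]
  simp

/-- An ideal that is minimal among those with finitely generated quotient lies in every `I n`, so
its quotient maps onto the free modules of unbounded rank `rank (n + 1)` over `R / M n`. -/
lemma not_isFairSized_colimit [IsNoetherianRing Rᵐᵒᵖ] (hr : ∀ n, 0 < T.r n)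
    (hM : ∀ n, T.M n ≠ ⊤)
    (hlen : ∀ n, Module.length Rᵐᵒᵖ (Rᵐᵒᵖ ⧸ mulRightIdeal Rᵐᵒᵖ (T.M n)) ≠ ⊤) :
    ¬ IsFairSized R T.colimit := by
  rintro ⟨K, hK, hmin⟩
  have hKI : ∀ n, K ≤ T.I n := fun n =>
    (hmin (inf_mem_finiteQuotientIdeals hK (T.I_mem_finiteQuotientIdeals n)) inf_le_left).trans
      inf_le_right
  have := hK.2
  obtain ⟨m, p, hp⟩ := exists_span_sup_eq_top (mulRightIdeal T.colimit K)
  have hp' : Submodule.span Rᵐᵒᵖ (Set.range p) ⊔ mulRightIdeal T.colimit (T.M m) = ⊤ :=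
    eq_top_iff.2 (hp.ge.trans (sup_le_sup_left
      (mulRightIdeal_mono ((hKI (m + 1)).trans (T.I_succ_le_M m))) _))
  have h := length_quotient_le hp'
  rw [length_colimit_quotient] at h
  have hpos := length_quotient_pos (hM m)
  obtain ⟨l, hl⟩ := ENat.ne_top_iff_exists.1 (hlen m)
  rw [← hl] at h hpos
  norm_cast at h hpos
  have h1 := Nat.le_of_mul_le_mul_right h hpos
  have h2 := T.lt_rank hr (m + 1)
  omega

end IdealTower

/-! ### A continuum of projective modules that are not fair sized -/

/-- The ranks are isomorphism invariants, since `R / M n` is a nonzero module of finite length. -/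
lemma rank_eq_of_colimit_equiv {R : Type u} [Ring R] {T T' : IdealTower R} (hMM : T.M = T'.M)
    (hM : ∀ n, T.M n ≠ ⊤)
    (hlen : ∀ n, Module.length Rᵐᵒᵖ (Rᵐᵒᵖ ⧸ mulRightIdeal Rᵐᵒᵖ (T.M n)) ≠ ⊤)
    (f : T.colimit ≃ₗ[Rᵐᵒᵖ] T'.colimit) (n : ℕ) : T.rank n = T'.rank n := by
  cases n with
  | zero => rfl
  | succ n =>
    have h := (Submodule.Quotient.equiv _ _ f (map_mulRightIdeal_equiv (T.M n) f)).length_eq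
    rw [T.length_colimit_quotient, hMM, T'.length_colimit_quotient, ← hMM] at h
    have hpos := length_quotient_pos (hM n)
    obtain ⟨l, hl⟩ := ENat.ne_top_iff_exists.1 (hlen n)
    rw [← hl] at h hpos
    norm_cast at h hpos
    exact Nat.eq_of_mul_eq_mul_right hpos h

/-- A finitely generated left ideal is generated by the first `r'` terms of a sequence, for every
sufficiently large `r'`. -/
lemma exists_generating_sequence {R : Type u} [Ring R] [IsNoetherianRing R] (I : Ideal R) :
    ∃ (r : ℕ) (y : ℕ → R), (∀ t, y t ∈ I) ∧ ∀ r', r ≤ r' → ∀ b ∈ I, ∃ s : ℕ → R,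
      b = ∑ t ∈ Finset.range r', s t * y t := by
  obtain ⟨r, x, hx⟩ := Submodule.fg_iff_exists_fin_generating_family.1
    ((isNoetherianRing_iff_ideal_fg R).1 inferInstance I)
  have hmem : ∀ i, x i ∈ I := fun i => hx ▸ Submodule.subset_span ⟨i, rfl⟩
  refine ⟨r, fun t => if h : t < r then x ⟨t, h⟩ else 0, fun t => ?_, fun r' hr b hb => ?_⟩
  · dsimp only
    split_ifs
    · exact hmem _
    · exact I.zero_mem
  · obtain ⟨c, rfl⟩ := (Submodule.mem_span_range_iff_exists_fun R).1 (hx.symm ▸ hb)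
    refine ⟨fun t => if h : t < r then c ⟨t, h⟩ else 0, ?_⟩
    rw [← Finset.sum_subset (Finset.range_subset_range.2 hr) fun t _ ht => by
      simp [Finset.mem_range.not.1 ht], Finset.sum_range]
    simp

theorem theorem7p3 (k : Type v) (R : Type u) [Field k] [Ring R] [Algebra k R]
    (hindec : IsIndecomposableRing R)
    (hdim : ¬ FiniteDimensional k R)
    (hleft : IsNoetherianRing R) (hright : IsNoetherianRing Rᵐᵒᵖ)
    (hFCR : IsFCRAlgebra k R)
    (I₀ : Ideal R) (hI₀ : I₀.IsTwoSided) (hcodim : FiniteDimensional k (R ⧸ I₀)) :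
    ∃ (ι : Type) (P : ι → ModuleCat.{u} Rᵐᵒᵖ), Uncountable ι ∧
      (∀ i j, i ≠ j → IsEmpty (P i ≃ₗ[Rᵐᵒᵖ] P j)) ∧
      ∀ i, IsCountablyGeneratedRight R (P i) ∧ Module.Projective Rᵐᵒᵖ (P i) ∧
        ¬ IsFairSized R (P i) ∧ traceIdeal R (P i) ≤ I₀ := by
  obtain ⟨I, M, e, rfl, h⟩ := hFCR.exists_ideal_sequence hdim I₀ hI₀ hcodim
  choose hI2 hIfin hM2 hMfin hM heM heI hIM using h
  -- The binary sequence `f` is recorded in the number of generators used for `I n`, that is, in the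
  -- ranks of the colimit modulo the `M n`; the summand `1` makes these ranks unbounded.
  choose r y hyI hy using fun n => exists_generating_sequence (I n)
  let T (f : ℕ → Bool) : IdealTower R :=
    { I := I, M := M, e := e, r := fun n => r n + 1 + (f n).toNat, y := y
      isTwoSided_I := hI2, isTwoSided_M := hM2, e_mem := heM, one_sub_e_mem := heI, I_succ := hIM
      I_le_mul_self := fun n => hFCR.le_mul_self (hIfin n)
      y_mem := hyI
      exists_sum := fun n => hy n _ (by omega) }
  have hlen : ∀ n, Module.length Rᵐᵒᵖ (Rᵐᵒᵖ ⧸ mulRightIdeal Rᵐᵒᵖ (M n)) ≠ ⊤ :=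
    fun n => length_quotient_ne_top (M n) (hMfin n)
  refine ⟨ℕ → Bool, fun f => ModuleCat.of Rᵐᵒᵖ (T f).colimit, ?_, fun f g hfg => ⟨fun φ => hfg ?_⟩,
    fun f => ⟨(T f).isCountablyGeneratedRight_colimit, (T f).projective_colimit,
      (T f).not_isFairSized_colimit (fun n => ?_) hM hlen, ?_⟩⟩
  · rw [← Cardinal.aleph0_lt_mk_iff]
    simpa using Cardinal.cantor Cardinal.aleph0
  · have hrank := rank_eq_of_colimit_equiv (T := T f) (T' := T g) rfl hM hlen φ
    funext n
    have h := hrank (n + 1)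
    rw [IdealTower.rank, IdealTower.rank, hrank n] at h
    have h' := Nat.eq_of_mul_eq_mul_left ((T g).rank_pos n) h
    have h'' : (f n).toNat = (g n).toNat := by
      simp only [T] at h'
      omega
    revert h''
    cases f n <;> cases g n <;> simp
  · exact Nat.add_pos_left (Nat.succ_pos _) _
  · exact traceIdeal_le (T f).mulRightIdeal_colimit_I_zero
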